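/- There is an absolute constant $c>0$ such that the following holds. Let $P$ be an irreducible transition matrix on a finite state space $V$ that is reversible with respect to its invariant distribution $\pi$. Let $\gamma = 1-\max\{\mu : \mu \text{ is an eigenvalue of } P,\ \mu\neq 1\}$ be its spectral gap and $t_{\rm rel}=1/\gamma$ its relaxation time. For $\lambda\in[0,1]$ let $$K_\lambda(x,y)=(1-\lambda)P(x,y)+\lambda\pi(y),\qquad x,y\in V,$$ and let $R_\lambda(x,y)$ be the effective resistance between $x$ and $y$ in the weighted graph on $V$ with edge weights $w_\lambda(x,y)=\pi(x)K_\lambda(x,y)$, that is, the potential difference between $x$ and $y$ when a unit electric current flows from $x$ to $y$ in the network with conductances $w_\lambda$. Then for every $\lambda$ with $0\le\lambda\le 1$ and $\lambda\le 1/t_{\rm rel}$, and all $x,y\in V$ with $x\neq y$, $$c\,R_0(x,y)\ \le\ R_\lambda(x,y)\ \le\ \frac{2}{2-\lambda}\,R_0(x,y).$$ -/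

import Mathlib

open scoped Matrix

namespace RestartChain

noncomputable section

/-- The matrix `K_r = (1 - r) P + r Π`, where every row of `Π` is `π`: with probability `r` the
chain restarts from `π`, otherwise it makes a step of `P`. -/
def restartMatrix {V : Type*} (P : Matrix V V ℝ) (π : V → ℝ) (r : ℝ) : Matrix V V ℝ :=
  Matrix.of fun x y => (1 - r) * P x y + r * π y

/-- The edge weights (conductances) `w(x, y) = π(x) K(x, y)` of a chain `K` reversible with
respect to `π`. -/
def edgeWeight {V : Type*} (π : V → ℝ) (K : Matrix V V ℝ) : V → V → ℝ :=
  fun x y => π x * K x y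

/-- The set of eigenvalues of `Q` other than `1`. (All eigenvalues of a reversible matrix are
real.) -/
def nontrivialEigenvalues {V : Type*} [Fintype V] [DecidableEq V] (Q : Matrix V V ℝ) : Set ℝ :=
  {μ | Module.End.HasEigenvalue (Matrix.toLin' Q) μ ∧ μ ≠ 1}

/-- The spectral gap `γ = 1 - max {μ : μ is an eigenvalue of Q, μ ≠ 1}`. The supremum is a maximum
of a finite nonempty set for an irreducible reversible chain on at least two states. -/
def spectralGap {V : Type*} [Fintype V] [DecidableEq V] (Q : Matrix V V ℝ) : ℝ :=
  1 - sSup (nontrivialEigenvalues Q)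

/-- The relaxation time `1 / γ`. -/
def relaxationTime {V : Type*} [Fintype V] [DecidableEq V] (Q : Matrix V V ℝ) : ℝ :=
  1 / spectralGap Q

/-- The net electric current flowing out of `u` in the network with conductances `w` when the
potential (voltage) is `φ`: by Ohm's law the current from `u` to `v` is `w u v * (φ u - φ v)`. -/
def netCurrent {V : Type*} [Fintype V] (w : V → V → ℝ) (φ : V → ℝ) (u : V) : ℝ :=
  ∑ v, w u v * (φ u - φ v)

/-- The potential `φ` drives a unit current from `a` to `z`: one unit enters the network at `a`
and leaves it at `z`, and Kirchhoff's node law holds at all other vertices. -/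
structure IsUnitCurrentPotential {V : Type*} [Fintype V] (w : V → V → ℝ) (a z : V)
    (φ : V → ℝ) : Prop where
  source : netCurrent w φ a = 1
  sink : netCurrent w φ z = -1
  node : ∀ u, u ≠ a → u ≠ z → netCurrent w φ u = 0

/-- The effective resistance between `a` and `z` in the weighted graph `(V, w)`: the potential
difference between `a` and `z` when a unit current flows from `a` to `z`. In a finite connected
network with symmetric nonnegative weights and `a ≠ z` such a potential exists and is unique up to
an additive constant, so that the infimum below is over a one-point set. -/
def effectiveResistance {V : Type*} [Fintype V] (w : V → V → ℝ) (a z : V) : ℝ :=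
  sInf {R : ℝ | ∃ φ : V → ℝ, IsUnitCurrentPotential w a z φ ∧ R = φ a - φ z}

/-- `R_r(x, y)`: the effective resistance between `x` and `y` in the network of `K_r`. -/
def restartResistance {V : Type*} [Fintype V] (P : Matrix V V ℝ) (π : V → ℝ) (r : ℝ)
    (x y : V) : ℝ :=
  effectiveResistance (edgeWeight π (restartMatrix P π r)) x y

/-- `P` is an irreducible transition matrix on the finite state space `V`, with invariant
distribution `π`, with respect to which it is reversible. -/
structure IsIrreducibleReversible {V : Type*} [Fintype V] [DecidableEq V] (P : Matrix V V ℝ)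
    (π : V → ℝ) : Prop where
  stochastic : P ∈ Matrix.rowStochastic ℝ V
  irreducible : P.IsIrreducible
  distribution : π ∈ stdSimplex ℝ V
  invariant : π ᵥ* P = π
  reversible : ∀ x y, π x * P x y = π y * P y x

end

end RestartChain

namespace RestartChain

open Finset

/-! ### Electrical networks: energy, potentials, monotonicity of resistance -/

section Network

variable {V : Type*} [Fintype V]

/-! Effective resistance is antitone in Dirichlet energy: if `energy w' ≤ C * energy w`, then R_w ≤
C R_{w'}. The energy of K_λ is the mixture (1-λ)E_P + λE_π, where E_π has weights π(u)π(v) and is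
four times the variance. So it suffices to compare E_P with E_π. The Poincaré inequality γE_π ≤ E_P
(`spectralGap_mul_energy_le`) and λ ≤ γ bound the mixture above by 2E_P. The bound E_P ≤ 2E_π
(`energy_le_two_mul`) bounds it below by (1-λ/2)E_P. These give c = 1/2 and the factor 2/(2-λ). -/

/-- Twice the Dirichlet energy of the potential `f` in the network with conductances `w`. -/
def energy (w : V → V → ℝ) (f : V → ℝ) : ℝ :=
  ∑ u, ∑ v, w u v * (f u - f v) ^ 2

theorem energy_nonneg {w : V → V → ℝ} (hw : ∀ u v, 0 ≤ w u v) (f : V → ℝ) : 0 ≤ energy w f :=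
  sum_nonneg fun u _ => sum_nonneg fun v _ => mul_nonneg (hw u v) (sq_nonneg _)

theorem energy_sub_const (w : V → V → ℝ) (f : V → ℝ) (a : ℝ) :
    energy w (fun u => f u - a) = energy w f := by
  simp [energy]

/-- Green's identity. -/
theorem two_mul_sum_mul_netCurrent {w : V → V → ℝ} (hw : ∀ u v, w u v = w v u) (f g : V → ℝ) :
    2 * ∑ u, g u * netCurrent w f u = ∑ u, ∑ v, w u v * ((f u - f v) * (g u - g v)) := by
  have h1 : ∑ u, g u * netCurrent w f u = ∑ u, ∑ v, w u v * (f u - f v) * g u :=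
    sum_congr rfl fun u _ => by rw [netCurrent, mul_comm, sum_mul]
  have h2 : ∑ u, g u * netCurrent w f u = ∑ u, ∑ v, -(w u v * (f u - f v) * g v) := by
    rw [h1, sum_comm]
    refine sum_congr rfl fun u _ => sum_congr rfl fun v _ => ?_
    rw [hw v u]
    ring
  rw [two_mul]
  nth_rewrite 1 [h1]
  rw [h2, ← sum_add_distrib]
  refine sum_congr rfl fun u _ => ?_
  rw [← sum_add_distrib]
  exact sum_congr rfl fun v _ => by ring

theorem two_mul_sum_mul_netCurrent_self {w : V → V → ℝ} (hw : ∀ u v, w u v = w v u)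
    (f : V → ℝ) : 2 * ∑ u, f u * netCurrent w f u = energy w f := by
  rw [two_mul_sum_mul_netCurrent hw, energy]
  simp only [sq]

theorem sum_netCurrent {w : V → V → ℝ} (hw : ∀ u v, w u v = w v u) (f : V → ℝ) :
    ∑ u, netCurrent w f u = 0 := by
  simpa using two_mul_sum_mul_netCurrent hw f (fun _ => 1)

theorem IsUnitCurrentPotential.sum_mul_netCurrent {w : V → V → ℝ} {a z : V} {φ : V → ℝ}
    (h : IsUnitCurrentPotential w a z φ) (haz : a ≠ z) (g : V → ℝ) :
    ∑ u, g u * netCurrent w φ u = g a - g z := by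
  classical
  rw [sum_eq_add_of_mem a z (mem_univ _) (mem_univ _) haz
    fun u _ hu => by rw [h.node u hu.1 hu.2, mul_zero], h.source, h.sink]
  ring

/-- By Green's identity a unit-current potential has energy twice its potential difference, and
pairing φ' with any g gives 2(g a - g z). Expanding 0 ≤ E_{w'}(Cφ' - φ) then yields the bound. -/
theorem IsUnitCurrentPotential.potential_difference_le {w w' : V → V → ℝ}
    (hw : ∀ u v, w u v = w v u) (hw' : ∀ u v, w' u v = w' v u) (hpos' : ∀ u v, 0 ≤ w' u v)
    {C : ℝ} (hC : 0 < C) (hle : ∀ f, energy w' f ≤ C * energy w f) {a z : V} (haz : a ≠ z)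
    {φ φ' : V → ℝ} (h : IsUnitCurrentPotential w a z φ) (h' : IsUnitCurrentPotential w' a z φ') :
    φ a - φ z ≤ C * (φ' a - φ' z) := by
  have e1 : energy w φ = 2 * (φ a - φ z) := by
    rw [← two_mul_sum_mul_netCurrent_self hw, h.sum_mul_netCurrent haz]
  have e2 : energy w' φ' = 2 * (φ' a - φ' z) := by
    rw [← two_mul_sum_mul_netCurrent_self hw', h'.sum_mul_netCurrent haz]
  have e3 : ∑ u, ∑ v, w' u v * ((φ' u - φ' v) * (φ u - φ v)) = 2 * (φ a - φ z) := by
    rw [← two_mul_sum_mul_netCurrent hw', h'.sum_mul_netCurrent haz]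
  have e4 : energy w' (fun u => C * φ' u - φ u)
      = C ^ 2 * energy w' φ' - 2 * C * ∑ u, ∑ v, w' u v * ((φ' u - φ' v) * (φ u - φ v))
        + energy w' φ := by
    simp only [energy, mul_sum, ← sum_sub_distrib, ← sum_add_distrib]
    exact sum_congr rfl fun u _ => sum_congr rfl fun v _ => by ring
  have h0 := energy_nonneg hpos' (fun u => C * φ' u - φ u)
  have h1 := hle φ
  rw [e4, e2, e3] at h0
  rw [e1] at h1
  have h2 : 0 ≤ C * (C * (φ' a - φ' z) - (φ a - φ z)) := by linarith
  have := nonneg_of_mul_nonneg_right h2 hC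
  linarith

theorem exists_isUnitCurrentPotential {w : V → V → ℝ} (hw : ∀ u v, w u v = w v u)
    (hconn : ∀ f, energy w f = 0 → ∀ u v, f u = f v) {a z : V} (haz : a ≠ z) :
    ∃ φ, IsUnitCurrentPotential w a z φ := by
  classical
  have hcard : (Fintype.card V : ℝ) ≠ 0 := by
    have : Nonempty V := ⟨a⟩
    exact_mod_cast Fintype.card_ne_zero
  -- The Laplacian kills constants; adding the total sum makes it injective, hence surjective. The
  -- target has total zero, so its preimage does too and the correction vanishes.
  let T : (V → ℝ) →ₗ[ℝ] (V → ℝ) :=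
    { toFun := fun f u => netCurrent w f u + ∑ v, f v
      map_add' := fun f g => by
        ext u
        simp only [netCurrent, Pi.add_apply, sum_add_distrib]
        rw [show ∑ v, w u v * (f u + g u - (f v + g v))
          = ∑ v, w u v * (f u - f v) + ∑ v, w u v * (g u - g v) by
            rw [← sum_add_distrib]; exact sum_congr rfl fun v _ => by ring]
        ring
      map_smul' := fun c f => by
        ext u
        simp only [netCurrent, Pi.smul_apply, smul_eq_mul, RingHom.id_apply, mul_add, mul_sum]
        congr 1
        exact sum_congr rfl fun v _ => by ring }
  have hT (f : V → ℝ) (u : V) : T f u = netCurrent w f u + ∑ v, f v := rfl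
  have hsum (f : V → ℝ) : ∑ u, T f u = Fintype.card V * ∑ v, f v := by
    simp only [hT, sum_add_distrib, sum_netCurrent hw, sum_const, card_univ, nsmul_eq_mul,
      zero_add]
  have hinj : Function.Injective T := by
    rw [← LinearMap.ker_eq_bot, LinearMap.ker_eq_bot']
    intro f hf
    have h0 : ∑ v, f v = 0 := by
      have := hsum f
      rw [hf] at this
      simpa [hcard] using this.symm
    have h1 (u : V) : netCurrent w f u = 0 := by
      have := hT f u
      rw [hf, h0] at this
      simpa using this.symm
    have h2 := hconn f (by simp [← two_mul_sum_mul_netCurrent_self hw, h1])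
    ext u
    rw [sum_congr rfl fun v _ => h2 v u] at h0
    simpa [hcard] using h0
  obtain ⟨φ, hφ⟩ := LinearMap.injective_iff_surjective.1 hinj
    (Pi.single a 1 - Pi.single z 1)
  have h0 : ∑ v, φ v = 0 := by
    have := hsum φ
    rw [hφ] at this
    simpa [hcard] using this.symm
  have h1 (u : V) : netCurrent w φ u = (Pi.single a 1 - Pi.single z 1 : V → ℝ) u := by
    rw [← hφ, hT, h0, add_zero]
  refine ⟨φ, ?_, ?_, fun u hua huz => ?_⟩
  · simp [h1, haz]
  · simp [h1, haz.symm]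
  · simp [h1, hua, huz]

theorem IsUnitCurrentPotential.effectiveResistance_eq {w : V → V → ℝ}
    (hw : ∀ u v, w u v = w v u) (hpos : ∀ u v, 0 ≤ w u v) {a z : V} (haz : a ≠ z) {φ : V → ℝ}
    (h : IsUnitCurrentPotential w a z φ) : effectiveResistance w a z = φ a - φ z := by
  have hset : {R : ℝ | ∃ φ : V → ℝ, IsUnitCurrentPotential w a z φ ∧ R = φ a - φ z}
      = {φ a - φ z} := by
    ext R
    constructor
    · rintro ⟨ψ, hψ, rfl⟩
      -- Uniqueness of the resistance is the comparison of the network with itself, with C = 1, in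
      -- both directions.
      have h1 := potential_difference_le hw hw hpos one_pos (fun f => (one_mul _).ge) haz h hψ
      have h2 := potential_difference_le hw hw hpos one_pos (fun f => (one_mul _).ge) haz hψ h
      exact le_antisymm (by linarith) (by linarith)
    · rintro rfl
      exact ⟨φ, h, rfl⟩
  rw [effectiveResistance, hset, csInf_singleton]

/-- Rayleigh monotonicity, in terms of energies. -/
theorem effectiveResistance_le_mul {w w' : V → V → ℝ}
    (hw : ∀ u v, w u v = w v u) (hw' : ∀ u v, w' u v = w' v u)
    (hpos : ∀ u v, 0 ≤ w u v) (hpos' : ∀ u v, 0 ≤ w' u v)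
    (hconn : ∀ f, energy w f = 0 → ∀ u v, f u = f v)
    (hconn' : ∀ f, energy w' f = 0 → ∀ u v, f u = f v)
    {C : ℝ} (hC : 0 < C) (hle : ∀ f, energy w' f ≤ C * energy w f) {a z : V} (haz : a ≠ z) :
    effectiveResistance w a z ≤ C * effectiveResistance w' a z := by
  obtain ⟨φ, h⟩ := exists_isUnitCurrentPotential hw hconn haz
  obtain ⟨φ', h'⟩ := exists_isUnitCurrentPotential hw' hconn' haz
  rw [h.effectiveResistance_eq hw hpos haz, h'.effectiveResistance_eq hw' hpos' haz]
  exact IsUnitCurrentPotential.potential_difference_le hw hw' hpos' hC hle haz h h'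

theorem sum_sum_mul_left {w : V → V → ℝ} {π : V → ℝ} (hrow : ∀ u, ∑ v, w u v = π u)
    (g : V → ℝ) : ∑ u, ∑ v, w u v * g u = ∑ u, π u * g u :=
  sum_congr rfl fun u _ => by rw [← sum_mul, hrow]

theorem sum_sum_mul_right {w : V → V → ℝ} (hw : ∀ u v, w u v = w v u) {π : V → ℝ}
    (hrow : ∀ u, ∑ v, w u v = π u) (g : V → ℝ) :
    ∑ u, ∑ v, w u v * g v = ∑ u, π u * g u := by
  rw [sum_comm, ← sum_sum_mul_left hrow]
  exact sum_congr rfl fun u _ => sum_congr rfl fun v _ => by rw [hw]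

theorem energy_eq {w : V → V → ℝ} (hw : ∀ u v, w u v = w v u) {π : V → ℝ}
    (hrow : ∀ u, ∑ v, w u v = π u) (f : V → ℝ) :
    energy w f = 2 * ∑ u, π u * f u ^ 2 - 2 * ∑ u, ∑ v, w u v * (f u * f v) := by
  have h : energy w f = ∑ u, ∑ v, w u v * f u ^ 2 + ∑ u, ∑ v, w u v * f v ^ 2
      - 2 * ∑ u, ∑ v, w u v * (f u * f v) := by
    simp only [energy, mul_sum, ← sum_sub_distrib, ← sum_add_distrib]
    exact sum_congr rfl fun u _ => sum_congr rfl fun v _ => by ring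
  rw [h, sum_sum_mul_left hrow fun u => f u ^ 2, sum_sum_mul_right hw hrow fun u => f u ^ 2]
  ring

theorem energy_le_four_mul {w : V → V → ℝ} (hw : ∀ u v, w u v = w v u)
    (hpos : ∀ u v, 0 ≤ w u v) {π : V → ℝ} (hrow : ∀ u, ∑ v, w u v = π u) (f : V → ℝ) :
    energy w f ≤ 4 * ∑ u, π u * f u ^ 2 := by
  have h : energy w f ≤ ∑ u, ∑ v, (2 * (w u v * f u ^ 2) + 2 * (w u v * f v ^ 2)) :=
    sum_le_sum fun u _ => sum_le_sum fun v _ => by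
      nlinarith [mul_nonneg (hpos u v) (sq_nonneg (f u + f v))]
  simp only [sum_add_distrib, ← mul_sum] at h
  rw [sum_sum_mul_left hrow fun u => f u ^ 2, sum_sum_mul_right hw hrow fun u => f u ^ 2] at h
  linarith

end Network

/-- Expand in an orthonormal eigenbasis: eigenvalues above β contribute nothing, since their
eigenvectors are orthogonal to g. -/
theorem isHermitian_dotProduct_mulVec_le {V : Type*} [Fintype V] [DecidableEq V]
    {S : Matrix V V ℝ} (hS : S.IsHermitian) {β : ℝ} {g : V → ℝ}
    (h : ∀ (μ : ℝ) (v : V → ℝ), v ≠ 0 → S *ᵥ v = μ • v → μ ≤ β ∨ v ⬝ᵥ g = 0) :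
    g ⬝ᵥ S *ᵥ g ≤ β * (g ⬝ᵥ g) := by
  let b := hS.eigenvectorBasis
  have hinner (x y : EuclideanSpace ℝ V) : inner ℝ x y = (x : V → ℝ) ⬝ᵥ (y : V → ℝ) := by
    simp [PiLp.inner_apply, dotProduct, mul_comm]
  have hexp (y : V → ℝ) : g ⬝ᵥ y = ∑ i, (⇑(b i) ⬝ᵥ g) * (⇑(b i) ⬝ᵥ y) := by
    have := b.sum_inner_mul_inner (WithLp.toLp 2 g) (WithLp.toLp 2 y)
    simp only [hinner] at this
    rw [← this]
    exact sum_congr rfl fun i _ => by rw [dotProduct_comm]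
  rw [hexp (S *ᵥ g), hexp g, mul_sum]
  refine sum_le_sum fun i _ => ?_
  have hv : S *ᵥ ⇑(b i) = hS.eigenvalues i • ⇑(b i) := hS.mulVec_eigenvectorBasis i
  have hSb : ⇑(b i) ⬝ᵥ S *ᵥ g = hS.eigenvalues i * (⇑(b i) ⬝ᵥ g) := by
    have hT : S.transpose = S := by simpa using hS.eq
    rw [Matrix.dotProduct_mulVec, ← Matrix.mulVec_transpose, hT, hv, smul_dotProduct, smul_eq_mul]
  rw [hSb]
  have hb0 : (⇑(b i) : V → ℝ) ≠ 0 := fun h0 =>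
    b.orthonormal.ne_zero i (by ext u; exact congrFun h0 u)
  rcases h _ _ hb0 hv with h1 | h1
  · nlinarith [mul_le_mul_of_nonneg_right h1 (sq_nonneg (⇑(b i) ⬝ᵥ g))]
  · simp [h1]

/-! ### Reversible chains: spectrum and energy comparison with π ⊗ π -/

namespace IsIrreducibleReversible

variable {V : Type*} [Fintype V] [DecidableEq V] {P : Matrix V V ℝ} {π : V → ℝ}

theorem row_sum (h : IsIrreducibleReversible P π) (u : V) : ∑ v, P u v = 1 := by
  have := congrFun (Matrix.mem_rowStochastic.1 h.stochastic).2 u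
  simpa [Matrix.mulVec, dotProduct] using this

/-- A property inherited along the transitions of the chain holds everywhere once it holds
somewhere. -/
theorem forall_of_step (h : IsIrreducibleReversible P π) {p : V → Prop}
    (hstep : ∀ u v, 0 < P u v → p u → p v) {a : V} (ha : p a) (z : V) : p z := by
  let : Quiver V := Matrix.toQuiver P
  obtain ⟨q, -⟩ := h.irreducible.connected a z
  induction q with
  | nil => exact ha
  | cons _ e ih => exact hstep _ _ e.down ih

theorem distribution_pos (h : IsIrreducibleReversible P π) (z : V) : 0 < π z := by
  obtain ⟨a, ha⟩ : ∃ a, 0 < π a := by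
    by_contra! hcon
    have := sum_nonpos fun u (_ : u ∈ univ) => hcon u
    rw [h.distribution.2] at this
    linarith
  refine h.forall_of_step (p := fun u => 0 < π u) (fun u v huv hu => ?_) ha z
  have h1 : 0 < π v * P v u := h.reversible u v ▸ mul_pos hu huv
  exact pos_of_mul_pos_left h1 (h.irreducible.nonneg v u)

theorem edgeWeight_symm (h : IsIrreducibleReversible P π) (u v : V) :
    edgeWeight π P u v = edgeWeight π P v u :=
  h.reversible u v

theorem edgeWeight_nonneg (h : IsIrreducibleReversible P π) (u v : V) :
    0 ≤ edgeWeight π P u v :=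
  mul_nonneg (h.distribution_pos u).le (h.irreducible.nonneg u v)

theorem sum_edgeWeight (h : IsIrreducibleReversible P π) (u : V) :
    ∑ v, edgeWeight π P u v = π u := by
  simp only [edgeWeight, ← mul_sum, h.row_sum, mul_one]

theorem eq_of_energy_eq_zero (h : IsIrreducibleReversible P π) {f : V → ℝ}
    (hf : energy (edgeWeight π P) f = 0) (u v : V) : f u = f v := by
  refine h.forall_of_step (p := fun v => f u = f v) (fun x y hxy hx => ?_) rfl v
  have hterm (x y : V) : 0 ≤ edgeWeight π P x y * (f x - f y) ^ 2 :=
    mul_nonneg (h.edgeWeight_nonneg x y) (sq_nonneg _)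
  have h1 := (sum_eq_zero_iff_of_nonneg fun x _ => sum_nonneg fun y _ => hterm x y).1 hf
    x (mem_univ x)
  have h2 := (sum_eq_zero_iff_of_nonneg fun y _ => hterm x y).1 h1 y (mem_univ y)
  rcases mul_eq_zero.1 h2 with h3 | h3
  · exact absurd h3 (mul_pos (h.distribution_pos x) hxy).ne'
  · rw [hx]
    exact sub_eq_zero.1 (pow_eq_zero_iff two_ne_zero |>.1 h3)

/-- Harmonic functions are constant. -/
theorem eq_of_mulVec_eq_self (h : IsIrreducibleReversible P π) {f : V → ℝ} (hf : P *ᵥ f = f)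
    (u v : V) : f u = f v := by
  refine h.eq_of_energy_eq_zero ?_ u v
  rw [energy_eq h.edgeWeight_symm h.sum_edgeWeight, ← mul_sub, ← sum_sub_distrib]
  refine mul_eq_zero_of_right _ (sum_eq_zero fun u _ => ?_)
  have h1 : ∑ v, P u v * f v = f u := congrFun hf u
  have h2 : ∑ v, edgeWeight π P u v * (f u * f v) = π u * f u * ∑ v, P u v * f v := by
    rw [mul_sum]
    exact sum_congr rfl fun v _ => by rw [edgeWeight]; ring
  rw [h2, h1]
  ring

theorem le_sSup_nontrivialEigenvalues {μ : ℝ} {f : V → ℝ} (hf0 : f ≠ 0) (hf : P *ᵥ f = μ • f)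
    (hμ : μ ≠ 1) : μ ≤ sSup (nontrivialEigenvalues P) := by
  -- Finiteness of the spectrum supplies the boundedness that a real `sSup` needs.
  refine le_csSup ((Module.End.finite_hasEigenvalue (Matrix.toLin' P)).subset
    fun _ hν => hν.1).bddAbove ⟨?_, hμ⟩
  exact Module.End.hasEigenvalue_of_hasEigenvector
    (Module.End.hasEigenvector_iff.2 ⟨Module.End.mem_eigenspace_iff.2 (by simpa using hf), hf0⟩)

theorem sum_sum_edgeWeight_mul_le (h : IsIrreducibleReversible P π) {f : V → ℝ}
    (hf : ∑ u, π u * f u = 0) :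
    ∑ u, ∑ v, edgeWeight π P u v * (f u * f v)
      ≤ sSup (nontrivialEigenvalues P) * ∑ u, π u * f u ^ 2 := by
  set s : V → ℝ := fun u => √(π u) with hs
  have hs0 (u : V) : s u ≠ 0 := (Real.sqrt_pos.2 (h.distribution_pos u)).ne'
  have hss (u : V) : s u * s u = π u := Real.mul_self_sqrt (h.distribution_pos u).le
  -- Conjugating by √π makes P symmetric; v is an eigenvector of S exactly when v/√π is one of P.
  let S : Matrix V V ℝ := Matrix.of fun u v => s u * P u v / s v
  have hSapp (u v : V) : S u v = s u * P u v / s v := rfl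
  have hS : S.IsHermitian := by
    ext u v
    have := h.reversible u v
    simp only [← hss] at this
    simp only [Matrix.conjTranspose_apply, star_trivial, hSapp]
    rw [div_eq_div_iff (hs0 _) (hs0 _)]
    linarith
  have key := isHermitian_dotProduct_mulVec_le (β := sSup (nontrivialEigenvalues P)) hS
    (g := fun u => s u * f u) ?_
  · have e1 : (fun u => s u * f u) ⬝ᵥ S *ᵥ (fun u => s u * f u)
        = ∑ u, ∑ v, edgeWeight π P u v * (f u * f v) := by
      simp only [dotProduct, Matrix.mulVec, mul_sum, hSapp]
      refine sum_congr rfl fun u _ => sum_congr rfl fun v _ => ?_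
      rw [edgeWeight, ← hss]
      field_simp [hs0 v]
    have e2 : (fun u => s u * f u) ⬝ᵥ (fun u => s u * f u) = ∑ u, π u * f u ^ 2 :=
      sum_congr rfl fun u _ => by rw [← hss]; ring
    rwa [e1, e2] at key
  · intro μ v hv0 hv
    have hPv : P *ᵥ (fun u => v u / s u) = μ • fun u => v u / s u := by
      ext u
      have h1 : ∑ y, s u * P u y / s y * v y = μ * v u := congrFun hv u
      have h2 : s u * ∑ y, P u y * (v y / s y) = μ * v u := by
        rw [← h1, mul_sum]
        exact sum_congr rfl fun y _ => by ring
      simp only [Matrix.mulVec, dotProduct, Pi.smul_apply, smul_eq_mul]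
      rw [← mul_div_assoc, eq_div_iff (hs0 u), mul_comm, h2]
    by_cases hμ : μ = 1
    -- For eigenvalue 1, v/√π is harmonic, hence constant, so v is orthogonal to √π f because f has
    -- mean zero.
    · right
      rw [hμ, one_smul] at hPv
      have hconst := h.eq_of_mulVec_eq_self hPv
      obtain ⟨a, -⟩ := Function.ne_iff.1 hv0
      have : v ⬝ᵥ (fun u => s u * f u) = v a / s a * ∑ u, π u * f u := by
        rw [mul_sum]
        refine sum_congr rfl fun u _ => ?_
        rw [hconst a u, ← hss]
        field_simp [hs0 u]
      rw [this, hf, mul_zero]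
    · left
      refine le_sSup_nontrivialEigenvalues (fun h0 => hv0 ?_) hPv hμ
      ext u
      simpa [hs0 u] using congrFun h0 u

theorem energy_mul_eq (h : IsIrreducibleReversible P π) {f : V → ℝ}
    (hf : ∑ u, π u * f u = 0) : energy (fun u v => π u * π v) f = 2 * ∑ u, π u * f u ^ 2 := by
  rw [energy_eq (π := π) (fun u v => mul_comm _ _)
    fun u => by rw [← mul_sum, h.distribution.2, mul_one]]
  have : ∑ u, ∑ v, π u * π v * (f u * f v) = (∑ u, π u * f u) * ∑ v, π v * f v := by
    rw [sum_mul_sum]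
    exact sum_congr rfl fun u _ => sum_congr rfl fun v _ => by ring
  rw [this, hf]
  ring

theorem sum_mul_sub_mean (h : IsIrreducibleReversible P π) (f : V → ℝ) :
    ∑ u, π u * (f u - ∑ v, π v * f v) = 0 := by
  simp only [mul_sub, sum_sub_distrib, ← sum_mul, h.distribution.2, one_mul, sub_self]

/-- The Poincaré inequality. -/
theorem spectralGap_mul_energy_le (h : IsIrreducibleReversible P π) (f : V → ℝ) :
    spectralGap P * energy (fun u v => π u * π v) f ≤ energy (edgeWeight π P) f := by
  have hf := h.sum_mul_sub_mean f
  rw [← energy_sub_const _ f (∑ v, π v * f v),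
    ← energy_sub_const (edgeWeight π P) f (∑ v, π v * f v), h.energy_mul_eq hf,
    energy_eq h.edgeWeight_symm h.sum_edgeWeight, spectralGap]
  linarith [h.sum_sum_edgeWeight_mul_le hf]

/-- After centring, (a-b)² ≤ 2a² + 2b² bounds the left energy by four times the variance, while the
π ⊗ π energy is twice the second moment. -/
theorem energy_le_two_mul (h : IsIrreducibleReversible P π) (f : V → ℝ) :
    energy (edgeWeight π P) f ≤ 2 * energy (fun u v => π u * π v) f := by
  have hf := h.sum_mul_sub_mean f
  rw [← energy_sub_const _ f (∑ v, π v * f v),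
    ← energy_sub_const (fun u v => π u * π v) f (∑ v, π v * f v), h.energy_mul_eq hf]
  linarith [energy_le_four_mul h.edgeWeight_symm h.edgeWeight_nonneg h.sum_edgeWeight
    fun u => f u - ∑ v, π v * f v]

end IsIrreducibleReversible

/-! ### The restart chain and the resistance bounds -/

theorem energy_edgeWeight_restartMatrix {V : Type*} [Fintype V] (P : Matrix V V ℝ) (π : V → ℝ)
    (r : ℝ) (f : V → ℝ) : energy (edgeWeight π (restartMatrix P π r)) f
      = (1 - r) * energy (edgeWeight π P) f + r * energy (fun u v => π u * π v) f := by
  simp only [energy, mul_sum, ← sum_add_distrib, edgeWeight, restartMatrix, Matrix.of_apply]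
  exact sum_congr rfl fun u _ => sum_congr rfl fun v _ => by ring

theorem restartMatrix_zero {V : Type*} (P : Matrix V V ℝ) (π : V → ℝ) :
    restartMatrix P π 0 = P := by
  ext
  simp [restartMatrix]

end RestartChain

open RestartChain in
theorem mainTheorem5 :
    ∃ c : ℝ, 0 < c ∧
      ∀ (V : Type*) [Fintype V] [DecidableEq V] (P : Matrix V V ℝ) (π : V → ℝ),
        RestartChain.IsIrreducibleReversible P π →
        ∀ r : ℝ, 0 ≤ r → r ≤ 1 → r ≤ 1 / RestartChain.relaxationTime P →
        ∀ x y : V, x ≠ y →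
          c * RestartChain.restartResistance P π 0 x y ≤ RestartChain.restartResistance P π r x y ∧
          RestartChain.restartResistance P π r x y ≤
            2 / (2 - r) * RestartChain.restartResistance P π 0 x y := by
  refine ⟨1 / 2, by norm_num, fun V _ _ P π h r hr0 hr1 hrel x y hxy => ?_⟩
  rw [relaxationTime, one_div_one_div] at hrel
  have hsymm (u v : V) : edgeWeight π (restartMatrix P π r) u v
      = edgeWeight π (restartMatrix P π r) v u := by
    simp only [edgeWeight, restartMatrix, Matrix.of_apply]
    linear_combination (1 - r) * h.reversible u v
  have hpos (u v : V) : 0 ≤ edgeWeight π (restartMatrix P π r) u v :=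
    mul_nonneg (h.distribution_pos u).le (add_nonneg
      (mul_nonneg (sub_nonneg.2 hr1) (h.irreducible.nonneg u v))
      (mul_nonneg hr0 (h.distribution_pos v).le))
  have hvar (f : V → ℝ) : 0 ≤ energy (fun u v => π u * π v) f :=
    energy_nonneg (fun u v => mul_nonneg (h.distribution_pos u).le (h.distribution_pos v).le) f
  have hlow (f : V → ℝ) : (2 - r) / 2 * energy (edgeWeight π P) f
      ≤ energy (edgeWeight π (restartMatrix P π r)) f := by
    rw [energy_edgeWeight_restartMatrix]
    linarith [mul_le_mul_of_nonneg_left (h.energy_le_two_mul f) hr0]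
  have hup (f : V → ℝ) : energy (edgeWeight π (restartMatrix P π r)) f
      -- Here λE_π ≤ γE_π ≤ E_P, and (1-λ)E_P ≤ E_P.
      ≤ 2 * energy (edgeWeight π P) f := by
    rw [energy_edgeWeight_restartMatrix]
    linarith [mul_le_mul_of_nonneg_right hrel (hvar f), h.spectralGap_mul_energy_le f,
      mul_nonneg hr0 (energy_nonneg h.edgeWeight_nonneg f)]
  have hr2 : 0 < (2 - r) / 2 := by linarith
  have hconn (f : V → ℝ) (hf : energy (edgeWeight π (restartMatrix P π r)) f = 0) (u v : V) :
      f u = f v := by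
    refine h.eq_of_energy_eq_zero (le_antisymm ?_ (energy_nonneg h.edgeWeight_nonneg f)) u v
    have := hlow f
    rw [hf] at this
    exact nonpos_of_mul_nonpos_right this hr2
  simp only [restartResistance, restartMatrix_zero]
  constructor
  · have := effectiveResistance_le_mul h.edgeWeight_symm hsymm h.edgeWeight_nonneg hpos
      (fun _ => h.eq_of_energy_eq_zero) hconn two_pos hup hxy
    linarith
  · refine effectiveResistance_le_mul hsymm h.edgeWeight_symm hpos h.edgeWeight_nonneg
      hconn (fun _ => h.eq_of_energy_eq_zero) (div_pos two_pos (by linarith)) (fun f => ?_) hxy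
    rw [← inv_div, inv_mul_eq_div, le_div_iff₀ hr2, mul_comm]
    exact hlow f
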